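/- Let $\Phi$ be a homogeneous Poisson point process in $\mathbb{R}^2$ of density $\lambda>0$ (a random locally finite set of points, called atoms). Two different atoms $x,y\in\Phi$ are mutually nearest neighbors if $y$ minimises $\|x-z\|$ over $z\in\Phi\setminus\{x\}$ and $x$ minimises $\|y-z\|$ over $z\in\Phi\setminus\{y\}$. Let $\Phi^{(2)}$ be the set of atoms of $\Phi$ that are mutually nearest neighbors with another atom, and let $\{0\curvearrowright\Phi^{(2)}\}$ be the event that the origin lies in the Voronoi cell (with respect to $\Phi$) of some atom of $\Phi^{(2)}$, where the Voronoi cell of $x\in\Phi$ is the set of points closer to $x$ than to any other atom of $\Phi$. For $r,s\ge 0$ and $\theta,\varphi\in[0,2\pi)$ let $x,y\in\mathbb{R}^2$ be the points with polar coordinates $(r,\theta)$ and $(s,\varphi)$, let $\rho=\|x-y\|$, and let $D(r,s,\theta,\varphi)$ be the area of $\bigl(B(x,\rho)\cup B(y,\rho)\bigr)\setminus B(0,r)$, where $B(z,t)$ is the open disc of centre $z$ and radius $t$. Then there is a measurable function $F:[0,\infty)\times[0,\infty)\times[0,2\pi)\times[0,2\pi)\to[0,\infty)$, which does not depend on $\lambda$,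 namely $F(r,s,\theta,\varphi)=D\bigl(r,\sqrt{r^2+s^2},\theta,\varphi\bigr)$, such that $$\mathbb{P}\bigl(0\curvearrowright\Phi^{(2)}\bigr)=\lambda^2\int_0^\infty\int_0^\infty\int_0^{2\pi}\int_0^{2\pi} s\,r\,e^{-\lambda F(r,s,\theta,\varphi)-\lambda\pi r^2}\,d\varphi\,d\theta\,dr\,ds .$$ Equivalently, $$\mathbb{P}\bigl(0\curvearrowright\Phi^{(2)}\bigr)=\lambda^2\int_0^\infty\int_r^\infty\int_0^{2\pi}\int_0^{2\pi} s\,r\,e^{-\lambda D(r,s,\theta,\varphi)-\lambda\pi r^2}\,d\varphi\,d\theta\,ds\,dr .$$ -/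

import Mathlib

open MeasureTheory ProbabilityTheory
open scoped NNReal ENNReal

/-- The Euclidean plane. -/
abbrev Plane : Type := EuclideanSpace ℝ (Fin 2)

/-- The point of the plane with polar coordinates `(r, θ)`. -/
noncomputable def polarPoint (r θ : ℝ) : Plane := !₂[r * Real.cos θ, r * Real.sin θ]

/-- `Φ` is a homogeneous Poisson point process of density `lam` in the plane, on the probability
space `(Ω, P)`. Its realisations are simple and locally finite configurations, that is, subsets
of the plane with finitely many points in each bounded set. The number of atoms in a bounded
Borel set is a random variable with the Poisson law of mean `lam` times the area of the set, and
the numbers of atoms in finitely many pairwise disjoint bounded Borel sets are independent. -/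
structure IsPoissonPointProcess {Ω : Type*} [MeasurableSpace Ω] (P : Measure Ω)
    (Φ : Ω → Set Plane) (lam : ℝ) : Prop where
  locallyFinite : ∀ (ω : Ω) (B : Set Plane), Bornology.IsBounded B → (Φ ω ∩ B).Finite
  measurable_count : ∀ B : Set Plane, MeasurableSet B → Bornology.IsBounded B →
    Measurable (fun ω => (Φ ω ∩ B).ncard)
  hasLaw_count : ∀ B : Set Plane, MeasurableSet B → Bornology.IsBounded B →
    HasLaw (fun ω => (Φ ω ∩ B).ncard) (poissonMeasure (Real.toNNReal (lam * volume.real B))) P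
  indep_count : ∀ (n : ℕ) (B : Fin n → Set Plane), (∀ i, MeasurableSet (B i)) →
    (∀ i, Bornology.IsBounded (B i)) → Pairwise (fun i j => Disjoint (B i) (B j)) →
    iIndepFun (fun i ω => (Φ ω ∩ B i).ncard) P

/-- The atom `x` is in nearest neighbor relation with the atom `y` in the configuration `φ`:
`x` and `y` are different atoms, and `y` minimises the distance to `x` over `φ \ {x}`. -/
def NearestNeighbor (φ : Set Plane) (x y : Plane) : Prop :=
  x ∈ φ ∧ y ∈ φ \ {x} ∧ ∀ z ∈ φ \ {x}, dist x y ≤ dist x z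

/-- The atoms `x` and `y` are mutually nearest neighbors in `φ`. -/
def MutuallyNearest (φ : Set Plane) (x y : Plane) : Prop :=
  NearestNeighbor φ x y ∧ NearestNeighbor φ y x

/-- The atoms of `φ` that cooperate, i.e. that are mutually nearest neighbors with another atom
of `φ`. -/
def pairedAtoms (φ : Set Plane) : Set Plane :=
  {x | x ∈ φ ∧ ∃ y ∈ φ, MutuallyNearest φ x y}

/-- The Voronoi cell of `x` in `φ`: the points of the plane that are closer to `x` than to any
other atom of `φ`. -/
def voronoiCell (φ : Set Plane) (x : Plane) : Set Plane :=
  {z | ∀ y ∈ φ, y ≠ x → dist z x < dist z y}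

/-- The event that the origin belongs to the Voronoi cell (with respect to the whole process `Φ`)
of some atom of the process of pairs. -/
def originInPairedCell {Ω : Type*} (Φ : Ω → Set Plane) : Set Ω :=
  {ω | ∃ x ∈ pairedAtoms (Φ ω), (0 : Plane) ∈ voronoiCell (Φ ω) x}

/-- The region `(B(x, ρ) ∪ B(y, ρ)) \ B(0, ‖x‖)` built from three open discs, where `ρ` is the
distance between `x` and `y`. -/
def threeDiscRegion (x y : Plane) : Set Plane :=
  (Metric.ball x (dist x y) ∪ Metric.ball y (dist x y)) \ Metric.ball 0 ‖x‖

/-- The area of the three-disc region of the points `x` and `y` with polar coordinates `(r, θ)`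
and `(s, φ)`. -/
noncomputable def threeDiscArea (r s θ φ : ℝ) : ℝ :=
  volume.real (threeDiscRegion (polarPoint r θ) (polarPoint s φ))

/-! Ignoring ties, the event holds exactly when there are atoms `x`, `y` with `‖x‖ < ‖y‖` such that
no third atom lies in the discs `B(0, ‖x‖)`, `B(x, ρ)`, `B(y, ρ)`, where `ρ = dist x y`. Here `x` is
the atom nearest to the origin and `y` its partner, so the ordered pair is unique, and the
probability equals the expected number of such pairs: `λ²` times the integral over `‖x‖ < ‖y‖` of
`exp(-λ · area)`, the area being that of the union of the discs, `πr² + D`. Polar coordinates give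
the second formula, and `s = √(r² + u²)` with `s ds = u du` gives the first.

The expected number is computed directly from the counts. Inside a bounded `K`, the plane is cut
into cells of radius `δ` around centres. One function, `discGap`, encodes the three disc conditions
and changes by at most `3δ` when the pair is moved to the centres (`discGap_le_add`). Demanding a
gap of `4δ` at the centres gives disjoint events inside `pairInside`, hence a lower bound;
tolerating `-4δ` gives a cover, hence an upper bound. Both tend to the same integral as `δ → 0`,
because the boundaries of the discs and the set `‖x‖ = ‖y‖` are null. Finally `K` exhausts the
plane. -/

/-! ### Poisson point masses and tail bounds. -/

lemma poissonMeasure_singleton_zero (m : ℝ≥0) :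
    poissonMeasure m {0} = ENNReal.ofReal (Real.exp (-m)) := by
  simp [poissonMeasure_singleton]

lemma poissonMeasure_singleton_one (m : ℝ≥0) :
    poissonMeasure m {1} = m * ENNReal.ofReal (Real.exp (-m)) := by
  rw [poissonMeasure_singleton]
  simp [mul_comm]

lemma poissonMeasure_one_le (m : ℝ≥0) : poissonMeasure m {k | 1 ≤ k} ≤ m := by
  have h : {k : ℕ | 1 ≤ k} = {0}ᶜ := by ext k; simp [Nat.one_le_iff_ne_zero]
  rw [h, prob_compl_eq_one_sub (measurableSet_singleton _), poissonMeasure_singleton_zero,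
    ← ENNReal.ofReal_one, ← ENNReal.ofReal_sub _ (Real.exp_pos _).le, ← ENNReal.ofReal_coe_nnreal]
  apply ENNReal.ofReal_le_ofReal
  linarith [Real.add_one_le_exp (-(m : ℝ))]

/-- Since `exp(-m) ≥ 1 - m`, one has `1 - (1 + m) exp(-m) ≤ 1 - (1 + m)(1 - m) = m²`. This
second-order bound makes two atoms in one small cell negligible. -/
lemma poissonMeasure_two_le (m : ℝ≥0) : poissonMeasure m {k | 2 ≤ k} ≤ m * m := by
  have h : {k : ℕ | 2 ≤ k} = {0, 1}ᶜ := by ext k; simp; omega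
  have h01 : poissonMeasure m {0, 1} = ENNReal.ofReal (Real.exp (-m) + m * Real.exp (-m)) := by
    rw [Set.insert_eq, measure_union (by simp) (measurableSet_singleton _),
      poissonMeasure_singleton_zero, poissonMeasure_singleton_one,
      ENNReal.ofReal_add (by positivity) (by positivity), ENNReal.ofReal_mul (by positivity),
      ENNReal.ofReal_coe_nnreal]
  rw [h, prob_compl_eq_one_sub (by measurability), h01,
    ← ENNReal.ofReal_one, ← ENNReal.ofReal_sub _ (by positivity), ← ENNReal.ofReal_coe_nnreal,
    ← ENNReal.ofReal_mul (by positivity)]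
  apply ENNReal.ofReal_le_ofReal
  nlinarith [Real.add_one_le_exp (-(m : ℝ)), m.2, Real.exp_pos (-(m : ℝ))]

lemma coe_toNNReal_mul_volume {lam : ℝ} (hlam : 0 < lam) {B : Set Plane}
    (hb : Bornology.IsBounded B) :
    ((Real.toNNReal (lam * volume.real B) : ℝ≥0) : ℝ≥0∞) = ENNReal.ofReal lam * volume B := by
  rw [← ENNReal.ofReal, ENNReal.ofReal_mul hlam.le, ofReal_measureReal hb.measure_lt_top.ne]

namespace IsPoissonPointProcess

variable {Ω : Type*} [MeasurableSpace Ω] {P : Measure Ω} {Φ : Ω → Set Plane} {lam : ℝ}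

lemma measure_count (h : IsPoissonPointProcess P Φ lam) {B : Set Plane} (hB : MeasurableSet B)
    (hb : Bornology.IsBounded B) (S : Set ℕ) :
    P {ω | (Φ ω ∩ B).ncard ∈ S} = poissonMeasure (Real.toNNReal (lam * volume.real B)) S :=
  (h.hasLaw_count B hB hb).measure_eq (p := fun k => k ∈ S) (MeasurableSet.of_discrete)

lemma measure_count_three (h : IsPoissonPointProcess P Φ lam) {A B V : Set Plane}
    (hA : MeasurableSet A) (hB : MeasurableSet B) (hV : MeasurableSet V)
    (hA' : Bornology.IsBounded A) (hB' : Bornology.IsBounded B) (hV' : Bornology.IsBounded V)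
    (hAB : Disjoint A B) (hAV : Disjoint A V) (hBV : Disjoint B V) (S T U : Set ℕ) :
    P {ω | (Φ ω ∩ A).ncard ∈ S ∧ (Φ ω ∩ B).ncard ∈ T ∧ (Φ ω ∩ V).ncard ∈ U} =
      poissonMeasure (Real.toNNReal (lam * volume.real A)) S *
      poissonMeasure (Real.toNNReal (lam * volume.real B)) T *
      poissonMeasure (Real.toNNReal (lam * volume.real V)) U := by
  have hi := h.indep_count 3 ![A, B, V]
    (by intro i; fin_cases i <;> simpa)
    (by intro i; fin_cases i <;> simpa)
    (by intro i j hij; fin_cases i <;> fin_cases j <;>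
          simp_all [disjoint_comm])
  have := hi.measure_inter_preimage_eq_mul Finset.univ (sets := ![S, T, U])
    (fun i _ => MeasurableSet.of_discrete)
  simp only [Fin.prod_univ_three, Finset.mem_univ, Set.iInter_true] at this
  rw [← h.measure_count hA hA' S, ← h.measure_count hB hB' T, ← h.measure_count hV hV' U]
  refine Eq.trans (congrArg P ?_) this
  ext ω
  simp [Fin.forall_fin_succ]

end IsPoissonPointProcess

/-! ### Discretisation into small cells. -/

/-- A measurable partition of a separable metric space into countably many cells of small
diameter. -/
lemma exists_measurable_cell_index {X : Type*} [PseudoMetricSpace X] [MeasurableSpace X]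
    [OpensMeasurableSpace X] [TopologicalSpace.SeparableSpace X] [Nonempty X] {δ : ℝ} (hδ : 0 < δ) :
    ∃ (k : X → ℕ) (c : ℕ → X), Measurable k ∧ ∀ x, dist x (c (k x)) < δ := by
  classical
  have hex : ∀ x : X, ∃ n, dist x (TopologicalSpace.denseSeq X n) < δ := by
    intro x
    exact (TopologicalSpace.denseRange_denseSeq X).exists_dist_lt x hδ
  refine ⟨fun x => Nat.find (hex x), TopologicalSpace.denseSeq X, measurable_find hex fun n => ?_,
    fun x => Nat.find_spec (hex x)⟩
  exact (isOpen_lt (by fun_prop) continuous_const).measurableSet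

/-- Reads a sum over cells as the integral of a step function, so that sums over pairs of centres
can be compared with integrals over `K`. -/
lemma setLIntegral_comp_index {X : Type*} [MeasurableSpace X] {μ : Measure X} {k : X → ℕ}
    (hk : Measurable k) (K : Set X) (g : ℕ → ℝ≥0∞) :
    ∫⁻ x in K, g (k x) ∂μ = ∑' a, g a * μ (k ⁻¹' {a} ∩ K) := by
  rw [← lintegral_map (μ := μ.restrict K) (f := g) (g := k) (measurable_of_countable _) hk,
    lintegral_countable']
  congr with a
  rw [Measure.map_apply hk (measurableSet_singleton a),
    Measure.restrict_apply (hk (measurableSet_singleton a))]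

/-! ### The gap function and its sublevel regions. -/

/-- The signed amount by which `z` violates being an obstacle for the pair `(x, y)`: it is negative
exactly when `z` lies in one of the open discs `B(0, ‖x‖)`, `B(x, ‖x - y‖)`, `B(y, ‖x - y‖)`. -/
noncomputable def discGap (x y z : Plane) : ℝ :=
  min (‖z‖ - ‖x‖) (min (dist z x) (dist z y) - dist x y)

/-- The sublevel sets of the gap. -/
def gapRegion (x y : Plane) (t : ℝ) : Set Plane := {z | discGap x y z < t}

lemma continuous_discGap : Continuous fun p : (Plane × Plane) × Plane => discGap p.1.1 p.1.2 p.2 := by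
  unfold discGap; fun_prop

/-- Moving `x` and `y` by `δ` changes `‖x‖`, `dist z x` and `dist z y` by at most `δ` each and `dist
x y` by at most `2δ`; the worst total is `3δ`. -/
lemma discGap_le_add {x y c d : Plane} {δ : ℝ} (hx : dist x c ≤ δ) (hy : dist y d ≤ δ)
    (z : Plane) : discGap x y z ≤ discGap c d z + 3 * δ := by
  have h1 : ‖c‖ ≤ ‖x‖ + δ := by
    have := norm_le_norm_add_norm_sub' c x
    rw [← dist_eq_norm, dist_comm] at this; linarith
  have h2 := dist_triangle z c x
  have h3 := dist_triangle z d y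
  have h4 := dist_triangle4 c x y d
  rw [dist_comm c x] at h2 h4
  rw [dist_comm d y] at h3
  have hδ : 0 ≤ δ := dist_nonneg.trans hx
  unfold discGap
  rcases le_total (‖z‖ - ‖c‖) (min (dist z c) (dist z d) - dist c d) with h | h
  · rw [min_eq_left h]
    refine (min_le_left _ _).trans ?_
    linarith
  · rw [min_eq_right h]
    refine (min_le_right _ _).trans ?_
    rcases le_total (dist z c) (dist z d) with h' | h'
    · rw [min_eq_left h']
      linarith [min_le_left (dist z x) (dist z y)]
    · rw [min_eq_right h']
      linarith [min_le_right (dist z x) (dist z y)]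

lemma discGap_le_left (x y z : Plane) : discGap x y z ≤ dist z x - dist x y :=
  (min_le_right _ _).trans (by linarith [min_le_left (dist z x) (dist z y)])

lemma discGap_le_right (x y z : Plane) : discGap x y z ≤ dist z y - dist x y :=
  (min_le_right _ _).trans (by linarith [min_le_right (dist z x) (dist z y)])

lemma measurableSet_gapRegion (x y : Plane) (t : ℝ) : MeasurableSet (gapRegion x y t) :=
  (isOpen_lt (continuous_discGap.comp (g := fun p : (Plane × Plane) × Plane => _)
    (f := fun z => ((x, y), z)) (by fun_prop)) continuous_const).measurableSet

lemma gapRegion_mono (x y : Plane) : Monotone (gapRegion x y) :=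
  fun _ _ h _ hz => lt_of_lt_of_le hz h

lemma isBounded_gapRegion (x y : Plane) (t : ℝ) : Bornology.IsBounded (gapRegion x y t) := by
  refine (Metric.isBounded_ball (x := (0 : Plane)) (r := t + ‖x‖ + ‖y‖ + dist x y)).subset ?_
  intro z hz
  rw [mem_ball_zero_iff]
  have hx := norm_nonneg x
  have hy := norm_nonneg y
  have hd : 0 ≤ dist x y := dist_nonneg
  have h1 := norm_le_norm_add_norm_sub' z x
  have h2 := norm_le_norm_add_norm_sub' z y
  rw [← dist_eq_norm] at h1 h2
  rcases min_lt_iff.1 (show min _ _ < t from hz) with h | h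
  · linarith
  · rw [sub_lt_iff_lt_add, min_lt_iff] at h
    rcases h with h | h <;> linarith

lemma gapRegion_zero (x y : Plane) :
    gapRegion x y 0 = Metric.ball 0 ‖x‖ ∪ threeDiscRegion x y := by
  ext z
  simp only [gapRegion, discGap, threeDiscRegion, Set.mem_ofPred_eq, Set.mem_union, Set.mem_sdiff,
    Metric.mem_ball, min_lt_iff, sub_neg, dist_zero_right]
  tauto

/-- The zero level lies on three spheres. This makes the area of `gapRegion x y t` continuous in `t`
at `0`. -/
lemma volume_discGap_eq_zero (x y : Plane) : volume {z | discGap x y z = 0} = 0 := by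
  refine measure_mono_null (t := Metric.sphere 0 ‖x‖ ∪ (Metric.sphere x (dist x y) ∪
    Metric.sphere y (dist x y))) ?_ ?_
  · intro z hz
    simp only [Set.mem_union, Metric.mem_sphere, dist_zero_right]
    change min _ _ = _ at hz
    rcases min_choice (‖z‖ - ‖x‖) (min (dist z x) (dist z y) - dist x y) with h | h
    · left; rw [h] at hz; linarith
    · right
      rw [h] at hz
      rcases min_choice (dist z x) (dist z y) with h' | h' <;> rw [h'] at hz
      · left; linarith
      · right; linarith
  · simp [Measure.addHaar_sphere]

/-! ### The pair density and its stability. -/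

/-- The density of ordered pairs of atoms with gap at least `t` from all other atoms. -/
noncomputable def pairWeight (lam t : ℝ) (x y : Plane) : ℝ≥0∞ :=
  if t < ‖y‖ - ‖x‖ then ENNReal.ofReal (Real.exp (-(lam * volume.real (gapRegion x y t)))) else 0

/-- Raising the threshold by `4δ` absorbs both the `3δ` error in the gap and the `2δ` error in `‖y‖
- ‖x‖`. -/
lemma pairWeight_le_of_dist_le {lam : ℝ} (hlam : 0 < lam) {x y c d : Plane} {δ t : ℝ}
    (hx : dist x c ≤ δ) (hy : dist y d ≤ δ) :
    pairWeight lam (t + 4 * δ) x y ≤ pairWeight lam t c d := by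
  have hδ : 0 ≤ δ := dist_nonneg.trans hx
  unfold pairWeight
  split_ifs with h1 h2
  · apply ENNReal.ofReal_le_ofReal
    rw [Real.exp_le_exp, neg_le_neg_iff]
    refine mul_le_mul_of_nonneg_left ?_ hlam.le
    refine measureReal_mono ?_ (isBounded_gapRegion _ _ _).measure_lt_top.ne
    intro z hz
    change discGap c d z < t at hz
    change discGap x y z < t + 4 * δ
    linarith [discGap_le_add hx hy z]
  · exfalso
    have h1' : ‖c‖ ≤ ‖x‖ + δ := by
      have := norm_le_norm_add_norm_sub' c x
      rw [← dist_eq_norm, dist_comm] at this; linarith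
    have h2' : ‖y‖ ≤ ‖d‖ + δ := by
      have := norm_le_norm_add_norm_sub' y d
      rw [← dist_eq_norm] at this; linarith
    linarith
  · exact bot_le
  · exact le_rfl

lemma pairWeight_le_one {lam : ℝ} (hlam : 0 < lam) (t : ℝ) (x y : Plane) :
    pairWeight lam t x y ≤ 1 := by
  unfold pairWeight
  split_ifs
  · rw [ENNReal.ofReal_le_one, Real.exp_le_one_iff]
    have := mul_nonneg hlam.le (measureReal_nonneg (μ := volume) (s := gapRegion x y t))
    linarith
  · exact bot_le

lemma measurable_volume_gapRegion (t : ℝ) :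
    Measurable fun p : Plane × Plane => volume (gapRegion p.1 p.2 t) :=
  measurable_measure_prodMk_left (ν := (volume : Measure Plane))
    (s := {p : (Plane × Plane) × Plane | discGap p.1.1 p.1.2 p.2 < t})
    (isOpen_lt continuous_discGap continuous_const).measurableSet

lemma measurable_pairWeight (lam t : ℝ) :
    Measurable fun p : Plane × Plane => pairWeight lam t p.1 p.2 := by
  unfold pairWeight
  refine Measurable.ite (measurableSet_lt measurable_const (by fun_prop)) ?_ measurable_const
  have := (measurable_volume_gapRegion t).ennreal_toReal
  exact ((this.const_mul lam).neg.exp).ennreal_ofReal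

lemma tendsto_pairWeight (lam : ℝ) {x y : Plane} (hxy : ‖y‖ ≠ ‖x‖) :
    Filter.Tendsto (fun t => pairWeight lam t x y) (nhds 0) (nhds (pairWeight lam 0 x y)) := by
  have hvol : Filter.Tendsto (fun t => volume (gapRegion x y t)) (nhds 0)
      (nhds (volume (gapRegion x y 0))) := by
    refine tendsto_measure_of_ae_tendsto_indicator (nhds 0) (measurableSet_gapRegion x y 0)
      (measurableSet_gapRegion x y) (measurableSet_gapRegion x y 1)
      (isBounded_gapRegion x y 1).measure_lt_top.ne ?_ ?_
    · filter_upwards [Iio_mem_nhds (zero_lt_one' ℝ)] with t ht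
      exact gapRegion_mono x y (le_of_lt ht)
    · have : ∀ᵐ z : Plane, discGap x y z ≠ 0 := by
        rw [ae_iff]; simpa using volume_discGap_eq_zero x y
      filter_upwards [this] with z hz
      rcases lt_or_gt_of_ne hz with h | h
      · filter_upwards [Ioi_mem_nhds h] with t ht
        exact iff_of_true ht h
      · filter_upwards [Iio_mem_nhds h] with t ht
        exact iff_of_false (fun hz' => lt_asymm hz' (Set.mem_Iio.1 ht)) (fun hz' => lt_asymm hz' h)
  have hreal := (ENNReal.tendsto_toReal (isBounded_gapRegion x y 0).measure_lt_top.ne).comp hvol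
  have hexp : Filter.Tendsto
      (fun t => ENNReal.ofReal (Real.exp (-(lam * volume.real (gapRegion x y t))))) (nhds 0)
      (nhds (ENNReal.ofReal (Real.exp (-(lam * volume.real (gapRegion x y 0)))))) :=
    ENNReal.tendsto_ofReal ((Real.continuous_exp.tendsto _).comp ((hreal.const_mul lam).neg))
  unfold pairWeight
  rcases lt_or_gt_of_ne (sub_ne_zero.2 hxy) with h | h
  · rw [if_neg (not_lt.2 h.le)]
    refine tendsto_const_nhds.congr' ?_
    filter_upwards [Ioi_mem_nhds h] with t ht
    exact (if_neg (not_lt.2 (le_of_lt ht))).symm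
  · rw [if_pos h]
    refine hexp.congr' ?_
    filter_upwards [Iio_mem_nhds h] with t ht
    exact (if_pos (Set.mem_Iio.1 ht)).symm

/-! ### Strict pairs and their uniqueness. -/

/-- Mutually nearest neighbors `x, y`, all of whose defining inequalities hold with margin. -/
structure StrictPair (φ : Set Plane) (x y : Plane) : Prop where
  left_mem : x ∈ φ
  right_mem : y ∈ φ
  norm_lt : ‖x‖ < ‖y‖
  gap_pos : ∀ z ∈ φ, z ≠ x → z ≠ y → 0 < discGap x y z

lemma discGap_pos_iff {x y z : Plane} :
    0 < discGap x y z ↔ ‖x‖ < ‖z‖ ∧ dist x y < dist z x ∧ dist x y < dist z y := by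
  simp [discGap, sub_pos]

lemma discGap_nonneg_iff {x y z : Plane} :
    0 ≤ discGap x y z ↔ ‖x‖ ≤ ‖z‖ ∧ dist x y ≤ dist z x ∧ dist x y ≤ dist z y := by
  simp [discGap, sub_nonneg]

namespace StrictPair

variable {φ : Set Plane} {x y x' y' : Plane}

lemma mutuallyNearest (h : StrictPair φ x y) : MutuallyNearest φ x y := by
  have hxy : y ≠ x := fun e => by simpa [e] using h.norm_lt
  refine ⟨⟨h.left_mem, ⟨h.right_mem, hxy⟩, ?_⟩, ⟨h.right_mem, ⟨h.left_mem, hxy.symm⟩, ?_⟩⟩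
  · rintro z ⟨hz, hzx⟩
    rcases eq_or_ne z y with rfl | hzy
    · exact le_rfl
    · rw [dist_comm x z]
      exact (discGap_pos_iff.1 (h.gap_pos z hz hzx hzy)).2.1.le
  · rintro z ⟨hz, hzy⟩
    rcases eq_or_ne z x with rfl | hzx
    · exact le_rfl
    · rw [dist_comm y z, dist_comm y x]
      exact (discGap_pos_iff.1 (h.gap_pos z hz hzx hzy)).2.2.le

lemma zero_mem_voronoiCell (h : StrictPair φ x y) : (0 : Plane) ∈ voronoiCell φ x := by
  intro z hz hzx
  rw [dist_zero_left, dist_zero_left]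
  rcases eq_or_ne z y with rfl | hzy
  · exact h.norm_lt
  · exact (discGap_pos_iff.1 (h.gap_pos z hz hzx hzy)).1

/-- Otherwise the origin would be strictly closer to each of `x`, `x'` than to the other. With
`eq_right`, this makes the events of the lower bound disjoint. -/
lemma eq_left (h : StrictPair φ x y) (h' : StrictPair φ x' y') : x = x' := by
  by_contra hne
  have h1 := h.zero_mem_voronoiCell x' h'.left_mem (Ne.symm hne)
  have h2 := h'.zero_mem_voronoiCell x h.left_mem hne
  exact lt_asymm h1 h2

/-- Once the first atoms agree, two different partners would each be strictly closer to `x` than the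
other. -/
lemma eq_right (h : StrictPair φ x y) (h' : StrictPair φ x' y') : y = y' := by
  obtain rfl := h.eq_left h'
  by_contra hne
  have hy : y ≠ x := h.mutuallyNearest.1.2.1.2
  have hy' : y' ≠ x := h'.mutuallyNearest.1.2.1.2
  have h1 := (discGap_pos_iff.1 (h.gap_pos y' h'.right_mem hy' (Ne.symm hne))).2.1
  have h2 := (discGap_pos_iff.1 (h'.gap_pos y h.right_mem hy hne)).2.1
  rw [dist_comm y' x] at h1
  rw [dist_comm y x] at h2
  exact lt_asymm h1 h2

end StrictPair

/-- The event that the origin lies in the cell of an atom `x ∈ K` whose partner is in `K`. -/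
def pairInside {Ω : Type*} (Φ : Ω → Set Plane) (K : Set Plane) : Set Ω :=
  {ω | ∃ x ∈ K, ∃ y ∈ K, MutuallyNearest (Φ ω) x y ∧ (0 : Plane) ∈ voronoiCell (Φ ω) x}

lemma MutuallyNearest.discGap_nonneg {φ : Set Plane} {x y z : Plane} (h : MutuallyNearest φ x y)
    (h0 : (0 : Plane) ∈ voronoiCell φ x) (hz : z ∈ φ) (hzx : z ≠ x) (hzy : z ≠ y) :
    0 ≤ discGap x y z := by
  have h1 := h0 z hz hzx
  rw [dist_zero_left, dist_zero_left] at h1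
  have h2 := h.1.2.2 z ⟨hz, hzx⟩
  have h3 := h.2.2.2 z ⟨hz, hzy⟩
  rw [dist_comm y z, dist_comm y x] at h3
  rw [dist_comm x z] at h2
  exact discGap_nonneg_iff.2 ⟨h1.le, h2, h3⟩

lemma abs_norm_sub_norm_le_of_dist {x c : Plane} {δ : ℝ} (hx : dist x c < δ) :
    ‖x‖ < ‖c‖ + δ ∧ ‖c‖ < ‖x‖ + δ := by
  have := abs_norm_sub_norm_le x c
  rw [← dist_eq_norm, abs_le] at this
  constructor <;> linarith [this.1, this.2]

/-! ### Discretised lower and upper bounds on a bounded set. -/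

namespace IsPoissonPointProcess

variable {Ω : Type*} [MeasurableSpace Ω] {P : Measure Ω} {Φ : Ω → Set Plane} {lam : ℝ}

lemma measurableSet_count (h : IsPoissonPointProcess P Φ lam) {B : Set Plane}
    (hB : MeasurableSet B) (hb : Bornology.IsBounded B) (S : Set ℕ) :
    MeasurableSet {ω | (Φ ω ∩ B).ncard ∈ S} :=
  h.measurable_count B hB hb (MeasurableSet.of_discrete (s := S))

/-- Probability of exactly one atom in each of `A`, `B` and none in the rest of `V ⊇ A ∪ B`. -/
lemma measure_single_single_void (h : IsPoissonPointProcess P Φ lam) (hlam : 0 < lam)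
    {A B V : Set Plane}
    (hA : MeasurableSet A) (hB : MeasurableSet B) (hV : MeasurableSet V)
    (hV' : Bornology.IsBounded V) (hAB : Disjoint A B) (hAV : A ⊆ V) (hBV : B ⊆ V) :
    P {ω | (Φ ω ∩ A).ncard ∈ ({1} : Set ℕ) ∧ (Φ ω ∩ B).ncard ∈ ({1} : Set ℕ) ∧
        (Φ ω ∩ (V \ (A ∪ B))).ncard ∈ ({0} : Set ℕ)} =
      ENNReal.ofReal lam ^ 2 * (volume A * volume B *
        ENNReal.ofReal (Real.exp (-(lam * volume.real V)))) := by
  have hA' := hV'.subset hAV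
  have hB' := hV'.subset hBV
  rw [h.measure_count_three hA hB (hV.diff (hA.union hB)) hA' hB' (hV'.subset Set.sdiff_subset) hAB
    (Set.disjoint_sdiff_right.mono_left Set.subset_union_left)
    (Set.disjoint_sdiff_right.mono_left Set.subset_union_right),
    poissonMeasure_singleton_one, poissonMeasure_singleton_one, poissonMeasure_singleton_zero,
    coe_toNNReal_mul_volume hlam hA', coe_toNNReal_mul_volume hlam hB']
  have hdiff : volume.real (V \ (A ∪ B)) = volume.real V - (volume.real A + volume.real B) := by
    rw [measureReal_sdiff (Set.union_subset hAV hBV) (hA.union hB)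
        hV'.measure_lt_top.ne,
      measureReal_union hAB hB hA'.measure_lt_top.ne hB'.measure_lt_top.ne]
  have hnn : ∀ s : Set Plane, ((Real.toNNReal (lam * volume.real s) : ℝ≥0) : ℝ) =
      lam * volume.real s := fun s => Real.coe_toNNReal _ (mul_nonneg hlam.le measureReal_nonneg)
  have hexp : ENNReal.ofReal (Real.exp (-(lam * volume.real V))) =
      ENNReal.ofReal (Real.exp (-(lam * volume.real A))) *
      ENNReal.ofReal (Real.exp (-(lam * volume.real B))) *
      ENNReal.ofReal (Real.exp (-(lam * volume.real (V \ (A ∪ B))))) := by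
    rw [← ENNReal.ofReal_mul (by positivity), ← ENNReal.ofReal_mul (by positivity),
      ← Real.exp_add, ← Real.exp_add, hdiff]
    ring_nf
  rw [hnn, hnn, hnn, hexp]
  ring

/-- `A` and `B` need not lie in `V`; removing them from the void costs at most the factor `exp(λ(|A|
+ |B|))`, which tends to `1` for small cells. -/
lemma measure_occupied_occupied_void_le (h : IsPoissonPointProcess P Φ lam) (hlam : 0 < lam)
    {A B V : Set Plane}
    (hA : MeasurableSet A) (hB : MeasurableSet B) (hV : MeasurableSet V)
    (hA' : Bornology.IsBounded A) (hB' : Bornology.IsBounded B)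
    (hV' : Bornology.IsBounded V) (hAB : Disjoint A B) :
    P {ω | (Φ ω ∩ A).ncard ∈ {k | 1 ≤ k} ∧ (Φ ω ∩ B).ncard ∈ {k | 1 ≤ k} ∧
        (Φ ω ∩ (V \ (A ∪ B))).ncard ∈ ({0} : Set ℕ)} ≤
      ENNReal.ofReal lam ^ 2 * (volume A * volume B *
        (ENNReal.ofReal (Real.exp (lam * (volume.real A + volume.real B))) *
          ENNReal.ofReal (Real.exp (-(lam * volume.real V))))) := by
  rw [h.measure_count_three hA hB (hV.diff (hA.union hB)) hA' hB' (hV'.subset Set.sdiff_subset) hAB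
    (Set.disjoint_sdiff_right.mono_left Set.subset_union_left)
    (Set.disjoint_sdiff_right.mono_left Set.subset_union_right), poissonMeasure_singleton_zero]
  have hdiff : volume.real V ≤ volume.real (V \ (A ∪ B)) + (volume.real A + volume.real B) := by
    have h1 := measureReal_mono (μ := volume) (show V ⊆ V \ (A ∪ B) ∪ (A ∪ B) by
      rw [Set.sdiff_union_self]; exact Set.subset_union_left)
      ((hV'.subset Set.sdiff_subset).union (hA'.union hB')).measure_lt_top.ne
    have h2 := measureReal_union_le (μ := volume) (V \ (A ∪ B)) (A ∪ B)
    have h3 := measureReal_union_le (μ := volume) A B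
    linarith
  calc _ ≤ (ENNReal.ofReal lam * volume A) * (ENNReal.ofReal lam * volume B) *
      ENNReal.ofReal (Real.exp (-(lam * volume.real (V \ (A ∪ B))))) := by
        gcongr
        · exact (poissonMeasure_one_le _).trans (coe_toNNReal_mul_volume hlam hA').le
        · exact (poissonMeasure_one_le _).trans (coe_toNNReal_mul_volume hlam hB').le
        · exact (Real.coe_toNNReal _ (mul_nonneg hlam.le measureReal_nonneg)).ge
    _ ≤ (ENNReal.ofReal lam * volume A) * (ENNReal.ofReal lam * volume B) *
      ENNReal.ofReal (Real.exp (lam * (volume.real A + volume.real B)) *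
        Real.exp (-(lam * volume.real V))) := by
        gcongr
        rw [← Real.exp_add, Real.exp_le_exp]
        nlinarith [mul_le_mul_of_nonneg_left hdiff hlam.le]
    _ = _ := by rw [ENNReal.ofReal_mul (by positivity)]; ring

lemma mem_of_count_eq_zero (h : IsPoissonPointProcess P Φ lam) {B : Set Plane}
    (hb : Bornology.IsBounded B) {ω : Ω} (h0 : (Φ ω ∩ B).ncard = 0) {z : Plane} (hz : z ∈ Φ ω) :
    z ∉ B := by
  rw [Set.ncard_eq_zero (h.locallyFinite ω B hb)] at h0
  exact fun hzB => (h0 ▸ (⟨hz, hzB⟩ : z ∈ Φ ω ∩ B) : z ∈ (∅ : Set Plane))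

lemma one_le_count (h : IsPoissonPointProcess P Φ lam) {B : Set Plane}
    (hb : Bornology.IsBounded B) {ω : Ω} {z : Plane} (hz : z ∈ Φ ω) (hzB : z ∈ B) :
    1 ≤ (Φ ω ∩ B).ncard :=
  Nat.one_le_iff_ne_zero.2 fun h0 => h.mem_of_count_eq_zero hb h0 hz hzB

/-- For each pair of centres with margin `4δ`, the event of one atom per cell and an otherwise empty
gap region forces a strict pair. Uniqueness makes these events disjoint, so their probabilities add
up exactly. -/
theorem exists_measurableSet_subset_pairInside (h : IsPoissonPointProcess P Φ lam)
    (hlam : 0 < lam) {K : Set Plane} (hK : MeasurableSet K) (hK' : Bornology.IsBounded K)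
    {δ : ℝ} (hδ : 0 < δ) :
    ∃ S, MeasurableSet S ∧ S ⊆ pairInside Φ K ∧
      ENNReal.ofReal lam ^ 2 * ∫⁻ x in K, ∫⁻ y in K, pairWeight lam (8 * δ) x y ≤ P S := by
  obtain ⟨k, c, hk, hc⟩ := exists_measurable_cell_index (X := Plane) hδ
  let C : ℕ → Set Plane := fun a => k ⁻¹' {a} ∩ K
  have hCm : ∀ a, MeasurableSet (C a) := fun a => (hk (measurableSet_singleton a)).inter hK
  have hCb : ∀ a, Bornology.IsBounded (C a) := fun a => hK'.subset Set.inter_subset_right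
  have hCc : ∀ {a x}, x ∈ C a → dist x (c a) < δ := by
    rintro a x ⟨hx, -⟩
    obtain rfl : k x = a := hx
    exact hc x
  have hCd : ∀ {a b}, a ≠ b → Disjoint (C a) (C b) := by
    intro a b hab
    rw [Set.disjoint_left]
    rintro x ⟨hx, -⟩ ⟨hx', -⟩
    exact hab (Eq.trans (Eq.symm hx) hx')
  let V : ℕ × ℕ → Set Plane := fun p => gapRegion (c p.1) (c p.2) (4 * δ)
  let L : ℕ × ℕ → Set Ω := fun p =>
    {ω | (Φ ω ∩ C p.1).ncard ∈ ({1} : Set ℕ) ∧ (Φ ω ∩ C p.2).ncard ∈ ({1} : Set ℕ) ∧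
        (Φ ω ∩ (V p \ (C p.1 ∪ C p.2))).ncard ∈ ({0} : Set ℕ)}
  let S : ℕ × ℕ → Set Ω := fun p => {ω | 4 * δ < ‖c p.2‖ - ‖c p.1‖ ∧ ω ∈ L p}
  have hVb : ∀ p, Bornology.IsBounded (V p \ (C p.1 ∪ C p.2)) := fun p =>
    (isBounded_gapRegion _ _ _).subset Set.sdiff_subset
  have hSm : ∀ p, MeasurableSet (S p) := by
    intro p
    refine (MeasurableSet.const _).inter ?_
    refine (h.measurableSet_count (hCm _) (hCb _) _).inter
      ((h.measurableSet_count (hCm _) (hCb _) _).inter (h.measurableSet_count ?_ (hVb p) _))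
    exact (measurableSet_gapRegion _ _ _).diff ((hCm _).union (hCm _))
  have hpair : ∀ p ω, ω ∈ S p → ∃ x ∈ C p.1, ∃ y ∈ C p.2, StrictPair (Φ ω) x y := by
    rintro p ω ⟨hn, h1, h2, h3⟩
    obtain ⟨x, hx⟩ := Set.ncard_eq_one.1 h1
    obtain ⟨y, hy⟩ := Set.ncard_eq_one.1 h2
    have hxm : x ∈ Φ ω ∩ C p.1 := hx ▸ Set.mem_singleton x
    have hym : y ∈ Φ ω ∩ C p.2 := hy ▸ Set.mem_singleton y
    have hxc := hCc hxm.2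
    have hyc := hCc hym.2
    refine ⟨x, hxm.2, y, hym.2, hxm.1, hym.1, ?_, ?_⟩
    · linarith [(abs_norm_sub_norm_le_of_dist hxc).1, (abs_norm_sub_norm_le_of_dist hyc).2]
    · intro z hz hzx hzy
      have hzV : z ∉ V p := by
        intro hzV
        refine h.mem_of_count_eq_zero (hVb p) h3 hz ⟨hzV, ?_⟩
        rintro (hz' | hz')
        · exact hzx (hx ▸ (⟨hz, hz'⟩ : z ∈ Φ ω ∩ C p.1) : z ∈ ({x} : Set Plane))
        · exact hzy (hy ▸ (⟨hz, hz'⟩ : z ∈ Φ ω ∩ C p.2) : z ∈ ({y} : Set Plane))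
      -- At most `3δ` is lost in passing from the centres to the atoms; the fourth `δ` keeps the gap
      -- strictly positive.
      have hzV' : 4 * δ ≤ discGap (c p.1) (c p.2) z := not_lt.1 hzV
      rw [dist_comm] at hxc hyc
      linarith [discGap_le_add hxc.le hyc.le z]
  refine ⟨⋃ p, S p, MeasurableSet.iUnion hSm, ?_, ?_⟩
  · intro ω hω
    obtain ⟨p, hp⟩ := Set.mem_iUnion.1 hω
    obtain ⟨x, hx, y, hy, hxy⟩ := hpair p ω hp
    exact ⟨x, hx.2, y, hy.2, hxy.mutuallyNearest, hxy.zero_mem_voronoiCell⟩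
  · have hdisj : Pairwise (Function.onFun Disjoint S) := by
      intro p q hpq
      refine Set.disjoint_left.2 fun ω hp hq => hpq ?_
      obtain ⟨x, hx, y, hy, hxy⟩ := hpair p ω hp
      obtain ⟨x', hx', y', hy', hxy'⟩ := hpair q ω hq
      obtain rfl := hxy.eq_left hxy'
      obtain rfl := hxy.eq_right hxy'
      exact Prod.ext (Eq.trans (Eq.symm hx.1) hx'.1) (Eq.trans (Eq.symm hy.1) hy'.1)
    have hSP : ∀ p, ENNReal.ofReal lam ^ 2 *
        (pairWeight lam (4 * δ) (c p.1) (c p.2) * volume (C p.2) * volume (C p.1)) = P (S p) := by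
      intro p
      by_cases hp : 4 * δ < ‖c p.2‖ - ‖c p.1‖
      -- The positive norm margin rules out diagonal pairs of cells.
      · have hne : p.1 ≠ p.2 := fun e => by rw [e, sub_self] at hp; linarith
        have hsub : ∀ {x}, x ∈ C p.1 → x ∈ V p := by
          intro x hx
          have := discGap_le_left (c p.1) (c p.2) x
          change discGap _ _ _ < _
          linarith [hCc hx, dist_nonneg (x := c p.1) (y := c p.2)]
        have hsub' : ∀ {x}, x ∈ C p.2 → x ∈ V p := by
          intro x hx
          have := discGap_le_right (c p.1) (c p.2) x
          change discGap _ _ _ < _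
          linarith [hCc hx, dist_nonneg (x := c p.1) (y := c p.2)]
        have hSL : S p = L p := by ext ω; exact and_iff_right hp
        rw [hSL]
        dsimp only [L]
        rw [h.measure_single_single_void hlam (hCm _) (hCm _)
          (measurableSet_gapRegion _ _ _) (isBounded_gapRegion _ _ _) (hCd hne)
          (fun _ hx => hsub hx) (fun _ hx => hsub' hx), pairWeight, if_pos hp]
        ring
      · have hS : S p = ∅ := by ext ω; exact iff_of_false (fun hω => hp hω.1) (Set.notMem_empty ω)
        rw [hS, pairWeight, if_neg hp]
        simp
    rw [measure_iUnion hdisj hSm]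
    simp_rw [← hSP]
    rw [ENNReal.tsum_mul_left]
    gcongr
    rw [ENNReal.tsum_prod (f := fun a b =>
      pairWeight lam (4 * δ) (c a) (c b) * volume (C b) * volume (C a))]
    simp_rw [ENNReal.tsum_mul_right]
    calc _ ≤ ∫⁻ x in K, ∫⁻ y in K, pairWeight lam (4 * δ) (c (k x)) (c (k y)) := by
          gcongr with x y
          have := pairWeight_le_of_dist_le hlam (t := 4 * δ) (hc x).le (hc y).le
          rwa [show 4 * δ + 4 * δ = 8 * δ by ring] at this
      _ = _ := by
          rw [setLIntegral_comp_index hk K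
            (fun a => ∫⁻ y in K, pairWeight lam (4 * δ) (c a) (c (k y)))]
          congr with a
          rw [setLIntegral_comp_index hk K (fun b => pairWeight lam (4 * δ) (c a) (c b))]

/-- Either both atoms share a cell, with total cost `∑ (λ|C a|)² ≤ λ²|B(0, δ)||K|`, or two different
cells are occupied and the relaxed gap region is otherwise empty. No measurability of `pairInside`
is needed for this union bound. -/
theorem measure_pairInside_le (h : IsPoissonPointProcess P Φ lam)
    (hlam : 0 < lam) {K : Set Plane} (hK : MeasurableSet K) (hK' : Bornology.IsBounded K)
    {δ : ℝ} (hδ : 0 < δ) :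
    P (pairInside Φ K) ≤ ENNReal.ofReal lam ^ 2 *
        (volume (Metric.ball (0 : Plane) δ) * volume K) +
      ENNReal.ofReal lam ^ 2 *
      (ENNReal.ofReal (Real.exp (lam * (2 * volume.real (Metric.ball (0 : Plane) δ)))) *
      ∫⁻ x in K, ∫⁻ y in K, pairWeight lam (-(8 * δ)) x y) := by
  obtain ⟨k, c, hk, hc⟩ := exists_measurable_cell_index (X := Plane) hδ
  let C : ℕ → Set Plane := fun a => k ⁻¹' {a} ∩ K
  have hCm : ∀ a, MeasurableSet (C a) := fun a => (hk (measurableSet_singleton a)).inter hK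
  have hCb : ∀ a, Bornology.IsBounded (C a) := fun a => hK'.subset Set.inter_subset_right
  have hCc : ∀ {a x}, x ∈ C a → dist x (c a) < δ := by
    rintro a x ⟨hx, -⟩
    obtain rfl : k x = a := hx
    exact hc x
  have hCv : ∀ a, volume (C a) ≤ volume (Metric.ball (0 : Plane) δ) := fun a =>
    (measure_mono fun x hx => Metric.mem_ball.2 (hCc hx)).trans_eq
      (Measure.addHaar_ball_center volume (c a) δ)
  have hCr : ∀ a, volume.real (C a) ≤ volume.real (Metric.ball (0 : Plane) δ) := fun a =>
    ENNReal.toReal_mono Metric.isBounded_ball.measure_lt_top.ne (hCv a)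
  have hCd : ∀ {a b}, a ≠ b → Disjoint (C a) (C b) := by
    intro a b hab
    rw [Set.disjoint_left]
    rintro x ⟨hx, -⟩ ⟨hx', -⟩
    exact hab (Eq.trans (Eq.symm hx) hx')
  let V : ℕ × ℕ → Set Plane := fun p => gapRegion (c p.1) (c p.2) (-(4 * δ))
  let U : ℕ × ℕ → Set Ω := fun p =>
    {ω | (Φ ω ∩ C p.1).ncard ∈ {k | 1 ≤ k} ∧ (Φ ω ∩ C p.2).ncard ∈ {k | 1 ≤ k} ∧
        (Φ ω ∩ (V p \ (C p.1 ∪ C p.2))).ncard ∈ ({0} : Set ℕ)}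
  let S : ℕ × ℕ → Set Ω := fun p =>
    {ω | p.1 ≠ p.2 ∧ -(4 * δ) < ‖c p.2‖ - ‖c p.1‖ ∧ ω ∈ U p}
  let T : ℕ → Set Ω := fun a => {ω | (Φ ω ∩ C a).ncard ∈ {k | 2 ≤ k}}
  have hcover : pairInside Φ K ⊆ (⋃ a, T a) ∪ ⋃ p, S p := by
    rintro ω ⟨x, hx, y, hy, hxy, h0⟩
    have hxΦ : x ∈ Φ ω := hxy.1.1
    have hyΦ : y ∈ Φ ω := hxy.2.1
    have hyx : y ≠ x := hxy.1.2.1.2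
    have hxC : x ∈ C (k x) := ⟨rfl, hx⟩
    have hyC : y ∈ C (k y) := ⟨rfl, hy⟩
    by_cases hk' : k x = k y
    · left
      refine Set.mem_iUnion.2 ⟨k x, ?_⟩
      change 1 < (Φ ω ∩ C (k x)).ncard
      rw [Set.one_lt_ncard_iff (h.locallyFinite ω _ (hCb _))]
      exact ⟨x, y, ⟨hxΦ, hxC⟩, ⟨hyΦ, hk' ▸ hyC⟩, hyx.symm⟩
    · right
      refine Set.mem_iUnion.2 ⟨(k x, k y), hk', ?_, h.one_le_count (hCb _) hxΦ hxC,
        h.one_le_count (hCb _) hyΦ hyC, ?_⟩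
      · have h1 := h0 y hyΦ hyx
        rw [dist_zero_left, dist_zero_left] at h1
        have h2 := (abs_norm_sub_norm_le_of_dist (hc x)).2
        have h3 := (abs_norm_sub_norm_le_of_dist (hc y)).1
        change -(4 * δ) < ‖c (k y)‖ - ‖c (k x)‖
        linarith
      · change (Φ ω ∩ _).ncard = 0
        rw [Set.ncard_eq_zero (h.locallyFinite ω _
          ((isBounded_gapRegion _ _ _).subset Set.sdiff_subset)), Set.eq_empty_iff_forall_notMem]
        rintro z ⟨hzΦ, hzV, hzC⟩
        have hzx : z ≠ x := fun e => hzC (Or.inl (e ▸ hxC))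
        have hzy : z ≠ y := fun e => hzC (Or.inr (e ▸ hyC))
        have h1 := hxy.discGap_nonneg h0 hzΦ hzx hzy
        have h2 := discGap_le_add (hc x).le (hc y).le z
        have h3 : discGap (c (k x)) (c (k y)) z < -(4 * δ) := hzV
        linarith
  refine (measure_mono hcover).trans ((measure_union_le _ _).trans (add_le_add ?_ ?_))
  · refine (measure_iUnion_le _).trans ?_
    calc ∑' a, P (T a) ≤ ∑' a, ENNReal.ofReal lam ^ 2 *
          (volume (Metric.ball (0 : Plane) δ) * volume (C a)) := by
          gcongr with a
          dsimp only [T]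
          rw [h.measure_count (hCm a) (hCb a)]
          refine (poissonMeasure_two_le _).trans ?_
          rw [coe_toNNReal_mul_volume hlam (hCb a)]
          calc _ = ENNReal.ofReal lam ^ 2 * (volume (C a) * volume (C a)) := by ring
            _ ≤ _ := mul_le_mul' le_rfl (mul_le_mul' (hCv a) le_rfl)
      _ = _ := by
          rw [ENNReal.tsum_mul_left, ENNReal.tsum_mul_left]
          have := setLIntegral_comp_index (μ := (volume : Measure Plane)) hk K (fun _ => 1)
          simp only [one_mul, setLIntegral_one] at this
          rw [this]
  · refine (measure_iUnion_le _).trans ?_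
    have hSP : ∀ p, P (S p) ≤ ENNReal.ofReal lam ^ 2 *
        (ENNReal.ofReal (Real.exp (lam * (2 * volume.real (Metric.ball (0 : Plane) δ)))) *
        (pairWeight lam (-(4 * δ)) (c p.1) (c p.2) * volume (C p.2) * volume (C p.1))) := by
      intro p
      by_cases hp : p.1 ≠ p.2 ∧ -(4 * δ) < ‖c p.2‖ - ‖c p.1‖
      · have hSU : S p ⊆ U p := fun ω hω => hω.2.2
        refine (measure_mono hSU).trans ((h.measure_occupied_occupied_void_le hlam (hCm _) (hCm _)
          (measurableSet_gapRegion _ _ _) (hCb _) (hCb _) (isBounded_gapRegion _ _ _)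
          (hCd hp.1)).trans ?_)
        rw [pairWeight, if_pos hp.2]
        calc _ ≤ ENNReal.ofReal lam ^ 2 * (volume (C p.1) * volume (C p.2) *
              (ENNReal.ofReal (Real.exp (lam * (2 * volume.real (Metric.ball (0 : Plane) δ)))) *
              ENNReal.ofReal (Real.exp (-(lam * volume.real (V p)))))) := by
              gcongr
              linarith [hCr p.1, hCr p.2]
          _ = _ := by ring
      · have hS : S p = ∅ := by
          ext ω; exact iff_of_false (fun hω => hp ⟨hω.1, hω.2.1⟩) (Set.notMem_empty ω)
        rw [hS, measure_empty]
        exact bot_le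
    refine (ENNReal.tsum_le_tsum hSP).trans ?_
    rw [ENNReal.tsum_mul_left, ENNReal.tsum_mul_left]
    gcongr
    rw [ENNReal.tsum_prod (f := fun a b =>
      pairWeight lam (-(4 * δ)) (c a) (c b) * volume (C b) * volume (C a))]
    simp_rw [ENNReal.tsum_mul_right]
    calc _ = ∫⁻ x in K, ∫⁻ y in K, pairWeight lam (-(4 * δ)) (c (k x)) (c (k y)) := by
          rw [setLIntegral_comp_index hk K
            (fun a => ∫⁻ y in K, pairWeight lam (-(4 * δ)) (c a) (c (k y)))]
          congr with a
          rw [setLIntegral_comp_index hk K (fun b => pairWeight lam (-(4 * δ)) (c a) (c b))]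
      _ ≤ _ := by
          gcongr with x y
          have hx := (hc x).le
          have hy := (hc y).le
          rw [dist_comm] at hx hy
          have := pairWeight_le_of_dist_le hlam (t := -(8 * δ)) hx hy
          rwa [show -(8 * δ) + 4 * δ = -(4 * δ) by ring] at this

end IsPoissonPointProcess

/-! ### The limit of small cells, then exhaustion of the plane. -/

lemma ae_norm_ne_norm : ∀ᵐ p : Plane × Plane, ‖p.2‖ ≠ ‖p.1‖ := by
  have hm : MeasurableSet {p : Plane × Plane | ‖p.2‖ = ‖p.1‖} :=
    (isClosed_eq (by fun_prop) (by fun_prop)).measurableSet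
  have h0 : (volume : Measure (Plane × Plane)) {p | ‖p.2‖ = ‖p.1‖} = 0 := by
    rw [Measure.volume_eq_prod, Measure.measure_prod_null hm]
    refine Filter.Eventually.of_forall fun x => ?_
    have : Prod.mk x ⁻¹' {p : Plane × Plane | ‖p.2‖ = ‖p.1‖} = Metric.sphere 0 ‖x‖ := by
      ext y; simp
    change volume (Prod.mk x ⁻¹' _) = 0
    rw [this]
    exact Measure.addHaar_sphere _ _ _
  rw [ae_iff]
  simpa using h0

lemma lintegral_pairWeight_eq_prod (lam t : ℝ) (K : Set Plane) :
    ∫⁻ x in K, ∫⁻ y in K, pairWeight lam t x y =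
      ∫⁻ p in K ×ˢ K, pairWeight lam t p.1 p.2 := by
  rw [Measure.volume_eq_prod, ← Measure.prod_restrict,
    lintegral_prod _ (measurable_pairWeight lam t).aemeasurable]

lemma tendsto_setLIntegral_pairWeight {lam : ℝ} (hlam : 0 < lam) {K : Set Plane}
    (hK' : Bornology.IsBounded K) :
    Filter.Tendsto (fun t => ∫⁻ x in K, ∫⁻ y in K, pairWeight lam t x y) (nhds 0)
      (nhds (∫⁻ x in K, ∫⁻ y in K, pairWeight lam 0 x y)) := by
  simp_rw [lintegral_pairWeight_eq_prod]
  refine tendsto_lintegral_filter_of_dominated_convergence (fun _ => 1)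
    (Filter.Eventually.of_forall fun t => measurable_pairWeight lam t)
    (Filter.Eventually.of_forall fun t => Filter.Eventually.of_forall fun p =>
      pairWeight_le_one hlam t p.1 p.2) ?_ ?_
  · rw [setLIntegral_one]
    exact (hK'.prod hK').measure_lt_top.ne
  · filter_upwards [ae_restrict_of_ae ae_norm_ne_norm] with p hp
    exact tendsto_pairWeight lam hp

namespace IsPoissonPointProcess

variable {Ω : Type*} [MeasurableSpace Ω] {P : Measure Ω} {Φ : Ω → Set Plane} {lam : ℝ}

theorem pairInside_spec [IsProbabilityMeasure P] (h : IsPoissonPointProcess P Φ lam)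
    (hlam : 0 < lam) {K : Set Plane} (hK : MeasurableSet K) (hK' : Bornology.IsBounded K) :
    NullMeasurableSet (pairInside Φ K) P ∧ P (pairInside Φ K) =
      ENNReal.ofReal lam ^ 2 * ∫⁻ x in K, ∫⁻ y in K, pairWeight lam 0 x y := by
  obtain ⟨δ, -, hδ, hδ0⟩ := exists_seq_strictAnti_tendsto (0 : ℝ)
  have hI := tendsto_setLIntegral_pairWeight hlam hK'
  have hl2 : ENNReal.ofReal lam ^ 2 ≠ ∞ := by finiteness
  have hup : P (pairInside Φ K) ≤
      ENNReal.ofReal lam ^ 2 * ∫⁻ x in K, ∫⁻ y in K, pairWeight lam 0 x y := by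
    have hball : Filter.Tendsto (fun n => volume (Metric.ball (0 : Plane) (δ n))) Filter.atTop
        (nhds 0) := by
      have h1 : Filter.Tendsto (fun n => ENNReal.ofReal (δ n) ^ 2 * ENNReal.ofReal Real.pi)
          Filter.atTop (nhds (ENNReal.ofReal 0 ^ 2 * ENNReal.ofReal Real.pi)) :=
        ENNReal.Tendsto.mul_const ((ENNReal.continuous_pow 2).tendsto _ |>.comp
          (ENNReal.tendsto_ofReal hδ0)) (Or.inr ENNReal.ofReal_ne_top)
      simpa [EuclideanSpace.volume_ball_fin_two] using h1
    have hballr : Filter.Tendsto (fun n => volume.real (Metric.ball (0 : Plane) (δ n)))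
        Filter.atTop (nhds 0) := (ENNReal.tendsto_toReal ENNReal.zero_ne_top).comp hball
    have hexp : Filter.Tendsto (fun n => ENNReal.ofReal
        (Real.exp (lam * (2 * volume.real (Metric.ball (0 : Plane) (δ n)))))) Filter.atTop
        (nhds 1) := by
      have := ENNReal.tendsto_ofReal
        ((Real.continuous_exp.tendsto _).comp ((hballr.const_mul 2).const_mul lam))
      simpa using this
    have hδ8 : Filter.Tendsto (fun n => -(8 * δ n)) Filter.atTop (nhds 0) := by
      simpa using (hδ0.const_mul 8).neg
    have hlim := (ENNReal.Tendsto.const_mul (a := ENNReal.ofReal lam ^ 2)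
      (ENNReal.Tendsto.mul_const (b := volume K) hball (Or.inr hK'.measure_lt_top.ne))
      (Or.inr hl2)).add
      (ENNReal.Tendsto.const_mul (a := ENNReal.ofReal lam ^ 2) (ENNReal.Tendsto.mul hexp
        (Or.inl one_ne_zero) (hI.comp hδ8) (Or.inr ENNReal.one_ne_top)) (Or.inr hl2))
    rw [zero_mul, mul_zero, zero_add, one_mul] at hlim
    exact ge_of_tendsto' hlim fun n => h.measure_pairInside_le hlam hK hK' (hδ n)
  choose S hSm hSs hSl using fun n =>
    h.exists_measurableSet_subset_pairInside hlam hK hK' (hδ n)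
  have hlow : ENNReal.ofReal lam ^ 2 * ∫⁻ x in K, ∫⁻ y in K, pairWeight lam 0 x y ≤
      P (⋃ n, S n) := by
    have hδ8 : Filter.Tendsto (fun n => 8 * δ n) Filter.atTop (nhds 0) := by
      simpa using hδ0.const_mul 8
    refine le_of_tendsto' (ENNReal.Tendsto.const_mul (hI.comp hδ8) (Or.inr hl2)) fun n => ?_
    exact (hSl n).trans (measure_mono (Set.subset_iUnion S n))
  have hsub : ⋃ n, S n ⊆ pairInside Φ K := Set.iUnion_subset hSs
  refine ⟨?_, le_antisymm hup (hlow.trans (measure_mono hsub))⟩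
  have hm := (MeasurableSet.iUnion hSm).nullMeasurableSet (μ := P)
  -- A measurable subset with the full outer measure of `pairInside` differs from it by a null set.
  exact hm.congr (ae_eq_of_subset_of_measure_ge hsub (hup.trans hlow) hm (measure_ne_top _ _))

lemma originInPairedCell_eq_iUnion {Ω : Type*} (Φ : Ω → Set Plane) :
    originInPairedCell Φ = ⋃ n : ℕ, pairInside Φ (Metric.ball 0 n) := by
  ext ω
  simp only [Set.mem_iUnion]
  constructor
  · rintro ⟨x, ⟨hx, y, hy, hxy⟩, h0⟩
    obtain ⟨n, hn⟩ := exists_nat_gt (max ‖x‖ ‖y‖)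
    exact ⟨n, x, mem_ball_zero_iff.2 ((le_max_left _ _).trans_lt hn), y,
      mem_ball_zero_iff.2 ((le_max_right _ _).trans_lt hn), hxy, h0⟩
  · rintro ⟨n, x, -, y, -, hxy, h0⟩
    exact ⟨x, ⟨hxy.1.1, y, hxy.2.1, hxy⟩, h0⟩

theorem originInPairedCell_spec [IsProbabilityMeasure P] (h : IsPoissonPointProcess P Φ lam)
    (hlam : 0 < lam) :
    NullMeasurableSet (originInPairedCell Φ) P ∧ P (originInPairedCell Φ) =
      ENNReal.ofReal lam ^ 2 * ∫⁻ p : Plane × Plane, pairWeight lam 0 p.1 p.2 := by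
  have hspec := fun n : ℕ =>
    h.pairInside_spec hlam (K := Metric.ball 0 n) measurableSet_ball Metric.isBounded_ball
  have hball : Monotone fun n : ℕ => Metric.ball (0 : Plane) n := fun m n hmn =>
    Metric.ball_subset_ball (Nat.cast_le.2 hmn)
  have hmono : Monotone fun n : ℕ => pairInside Φ (Metric.ball 0 n) := by
    rintro m n hmn ω ⟨x, hx, y, hy, hxy⟩
    exact ⟨x, hball hmn hx, y, hball hmn hy, hxy⟩
  rw [originInPairedCell_eq_iUnion]
  refine ⟨NullMeasurableSet.iUnion fun n => (hspec n).1, ?_⟩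
  rw [hmono.measure_iUnion]
  simp_rw [(hspec _).2, lintegral_pairWeight_eq_prod]
  rw [← ENNReal.mul_iSup]
  congr 1
  -- Taking the pair density as a measure turns the limit over growing balls into continuity from
  -- below.
  let ν := (volume : Measure (Plane × Plane)).withDensity fun p => pairWeight lam 0 p.1 p.2
  have hν : ∀ n : ℕ, ∫⁻ p in Metric.ball (0 : Plane) n ×ˢ Metric.ball (0 : Plane) n,
      pairWeight lam 0 p.1 p.2 = ν (Metric.ball (0 : Plane) n ×ˢ Metric.ball (0 : Plane) n) :=
    fun n => (withDensity_apply _ (measurableSet_ball.prod measurableSet_ball)).symm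
  simp_rw [hν]
  have hmono' : Monotone fun n : ℕ => Metric.ball (0 : Plane) n ×ˢ Metric.ball (0 : Plane) n :=
    fun m n hmn => Set.prod_mono (hball hmn) (hball hmn)
  rw [← hmono'.measure_iUnion]
  have huniv : ⋃ n : ℕ, Metric.ball (0 : Plane) n ×ˢ Metric.ball (0 : Plane) n = Set.univ := by
    refine Set.eq_univ_of_forall fun p => ?_
    obtain ⟨n, hn⟩ := exists_nat_gt (max ‖p.1‖ ‖p.2‖)
    exact Set.mem_iUnion.2 ⟨n, mem_ball_zero_iff.2 ((le_max_left _ _).trans_lt hn),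
      mem_ball_zero_iff.2 ((le_max_right _ _).trans_lt hn)⟩
  rw [huniv, withDensity_apply _ MeasurableSet.univ, Measure.restrict_univ]

end IsPoissonPointProcess

/-! ### Polar coordinates. -/

lemma continuous_polarPoint : Continuous fun p : ℝ × ℝ => polarPoint p.1 p.2 := by
  unfold polarPoint
  refine (PiLp.continuous_toLp 2 _).comp (continuous_pi fun i => ?_)
  fin_cases i <;> simp <;> fun_prop

lemma measurable_polarPoint_comp {X : Type*} [MeasurableSpace X] {f g : X → ℝ}
    (hf : Measurable f) (hg : Measurable g) : Measurable fun q => polarPoint (f q) (g q) :=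
  continuous_polarPoint.measurable.comp (hf.prodMk hg)

lemma norm_polarPoint {r : ℝ} (hr : 0 ≤ r) (θ : ℝ) : ‖polarPoint r θ‖ = r := by
  rw [EuclideanSpace.norm_eq, Real.sqrt_eq_iff_eq_sq (by positivity) hr]
  simp only [polarPoint, Fin.sum_univ_two, Real.norm_eq_abs, sq_abs]
  simp
  linear_combination r ^ 2 * Real.sin_sq_add_cos_sq θ

lemma polarPoint_add_two_pi (r θ : ℝ) : polarPoint r (θ + 2 * Real.pi) = polarPoint r θ := by
  simp [polarPoint]

/-- Used to move the angular range from `(-π, π]` to `(0, 2π]`. -/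
lemma Function.Periodic.setLIntegral_Ioc_eq {g : ℝ → ℝ≥0∞} {T : ℝ} (hg : Function.Periodic g T)
    (hT : 0 < T) (a b : ℝ) :
    ∫⁻ θ in Set.Ioc a (a + T), g θ = ∫⁻ θ in Set.Ioc b (b + T), g θ := by
  refine (isAddFundamentalDomain_Ioc hT a).setLIntegral_eq (isAddFundamentalDomain_Ioc hT b) g ?_
  rintro ⟨_, n, rfl⟩ x
  have := hg.zsmul n x
  rwa [add_comm] at this

lemma measurePreserving_toPlane :
    MeasurePreserving (fun p : ℝ × ℝ => (!₂[p.1, p.2] : Plane)) := by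
  have h1 := (volume_preserving_finTwoArrow ℝ).symm
  have h2 := PiLp.volume_preserving_toLp (Fin 2)
  exact h2.comp h1

theorem lintegral_plane_polar {f : Plane → ℝ≥0∞} (hf : Measurable f) :
    ∫⁻ x, f x = ∫⁻ r in Set.Ioi (0 : ℝ), ∫⁻ θ in Set.Ico (0 : ℝ) (2 * Real.pi),
      ENNReal.ofReal r * f (polarPoint r θ) := by
  rw [← measurePreserving_toPlane.lintegral_comp hf, ← lintegral_comp_polarCoord_symm,
    polarCoord_target, Measure.volume_eq_prod, setLIntegral_prod]
  · refine setLIntegral_congr_fun measurableSet_Ioi fun r _ => ?_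
    have hper : Function.Periodic (fun θ => ENNReal.ofReal r * f (polarPoint r θ))
        (2 * Real.pi) := fun θ => by simp only [polarPoint_add_two_pi]
    have := hper.setLIntegral_Ioc_eq Real.two_pi_pos (-Real.pi) 0
    rw [zero_add, show -Real.pi + 2 * Real.pi = Real.pi by ring] at this
    rw [setLIntegral_congr (Ioo_ae_eq_Ioc (a := -Real.pi) (b := Real.pi)),
      setLIntegral_congr (Ico_ae_eq_Ioc (a := (0 : ℝ)) (b := 2 * Real.pi)), ← this]
    rfl
  · refine Measurable.aemeasurable ?_
    exact (measurable_fst.ennreal_ofReal).mul (hf.comp continuous_polarPoint.measurable)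

lemma volume_gapRegion_zero (x y : Plane) :
    volume.real (gapRegion x y 0) = Real.pi * ‖x‖ ^ 2 + volume.real (threeDiscRegion x y) := by
  have hb := (isBounded_gapRegion x y 0).measure_lt_top (μ := volume)
  have h2 : volume.real (threeDiscRegion x y) =
      volume.real (gapRegion x y 0) - volume.real (Metric.ball (0 : Plane) ‖x‖) := by
    have hsub : Metric.ball (0 : Plane) ‖x‖ ⊆ gapRegion x y 0 := by
      rw [gapRegion_zero]; exact Set.subset_union_left
    rw [← measureReal_sdiff hsub measurableSet_ball hb.ne, gapRegion_zero, Set.union_sdiff_left]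
    unfold threeDiscRegion
    rw [sdiff_sdiff_left, sup_idem]
  have h3 : volume.real (Metric.ball (0 : Plane) ‖x‖) = Real.pi * ‖x‖ ^ 2 := by
    rw [measureReal_def, EuclideanSpace.volume_ball_fin_two]
    simp [Real.pi_pos.le, mul_comm]
  linarith

/-- Writing `‖polarPoint r θ‖` rather than `r` covers negative `r` too, so measurability of the area
follows on all of `ℝ⁴`. -/
lemma threeDiscArea_eq {r : ℝ} (s θ φ : ℝ) :
    threeDiscArea r s θ φ = volume.real (gapRegion (polarPoint r θ) (polarPoint s φ) 0) -
      Real.pi * ‖polarPoint r θ‖ ^ 2 := by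
  rw [volume_gapRegion_zero, threeDiscArea]; ring

lemma measurable_threeDiscArea :
    Measurable fun p : ℝ × ℝ × ℝ × ℝ => threeDiscArea p.1 p.2.1 p.2.2.1 p.2.2.2 := by
  simp_rw [threeDiscArea_eq]
  have hx : Measurable fun p : ℝ × ℝ × ℝ × ℝ => polarPoint p.1 p.2.2.1 :=
    measurable_polarPoint_comp (by fun_prop) (by fun_prop)
  have hy : Measurable fun p : ℝ × ℝ × ℝ × ℝ => polarPoint p.2.1 p.2.2.2 :=
    measurable_polarPoint_comp (by fun_prop) (by fun_prop)
  have := ((measurable_volume_gapRegion 0).comp (hx.prodMk hy)).ennreal_toReal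
  exact this.sub ((hx.norm.pow_const 2).const_mul _)

lemma ofReal_mul_pairWeight_polarPoint (lam : ℝ) {r s : ℝ} (hr : 0 < r) (hs : 0 < s) (θ φ : ℝ) :
    ENNReal.ofReal r * (ENNReal.ofReal s *
      pairWeight lam 0 (polarPoint r θ) (polarPoint s φ)) =
    if r < s then ENNReal.ofReal
      (s * r * Real.exp (-lam * threeDiscArea r s θ φ - lam * Real.pi * r ^ 2)) else 0 := by
  unfold pairWeight
  rw [norm_polarPoint hr.le, norm_polarPoint hs.le]
  simp only [sub_pos]
  split_ifs
  · rw [← ENNReal.ofReal_mul hs.le, ← ENNReal.ofReal_mul hr.le, volume_gapRegion_zero,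
      norm_polarPoint hr.le, threeDiscArea]
    ring_nf
  · simp

theorem lintegral_plane_prod_polar {w : Plane × Plane → ℝ≥0∞} (hw : Measurable w) :
    ∫⁻ p, w p = ∫⁻ r in Set.Ioi (0 : ℝ), ∫⁻ s in Set.Ioi (0 : ℝ),
      ∫⁻ θ in Set.Ico (0 : ℝ) (2 * Real.pi), ∫⁻ φ in Set.Ico (0 : ℝ) (2 * Real.pi),
        ENNReal.ofReal r * (ENNReal.ofReal s * w (polarPoint r θ, polarPoint s φ)) := by
  have hpol : ∀ x : Plane, ∫⁻ y, w (x, y) = ∫⁻ s in Set.Ioi (0 : ℝ),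
      ∫⁻ φ in Set.Ico (0 : ℝ) (2 * Real.pi), ENNReal.ofReal s * w (x, polarPoint s φ) := fun x =>
    lintegral_plane_polar (f := fun y => w (x, y)) (hw.comp measurable_prodMk_left)
  rw [Measure.volume_eq_prod, lintegral_prod _ hw.aemeasurable,
    lintegral_plane_polar (f := fun x => ∫⁻ y, w (x, y)) hw.lintegral_prod_right']
  refine lintegral_congr fun r => ?_
  have hG : Measurable fun q : (ℝ × ℝ) × ℝ => ENNReal.ofReal r * (ENNReal.ofReal q.1.2 *
      w (polarPoint r q.1.1, polarPoint q.1.2 q.2)) := by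
    refine (Measurable.mul (by fun_prop) (hw.comp (Measurable.prodMk ?_ ?_))).const_mul _
    · exact measurable_polarPoint_comp measurable_const (by fun_prop)
    · exact measurable_polarPoint_comp (by fun_prop) (by fun_prop)
  have hG' : Measurable fun q : ℝ × ℝ => ∫⁻ φ in Set.Ico (0 : ℝ) (2 * Real.pi),
      ENNReal.ofReal r * (ENNReal.ofReal q.2 * w (polarPoint r q.1, polarPoint q.2 φ)) :=
    hG.lintegral_prod_right'
  rw [lintegral_lintegral_swap (f := fun s θ => ∫⁻ φ in Set.Ico (0 : ℝ) (2 * Real.pi),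
    ENNReal.ofReal r * (ENNReal.ofReal s * w (polarPoint r θ, polarPoint s φ)))
    (hG'.comp measurable_swap).aemeasurable]
  refine lintegral_congr fun θ => ?_
  simp_rw [hpol, lintegral_const_mul' _ _ ENNReal.ofReal_ne_top]

/-- The pair integral in polar coordinates. -/
theorem lintegral_pairWeight_polar (lam : ℝ) :
    ∫⁻ p : Plane × Plane, pairWeight lam 0 p.1 p.2 =
      ∫⁻ r in Set.Ioi (0 : ℝ), ∫⁻ s in Set.Ioi r,
        ∫⁻ θ in Set.Ico (0 : ℝ) (2 * Real.pi), ∫⁻ φ in Set.Ico (0 : ℝ) (2 * Real.pi),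
          ENNReal.ofReal
            (s * r * Real.exp (-lam * threeDiscArea r s θ φ - lam * Real.pi * r ^ 2)) := by
  rw [lintegral_plane_prod_polar (measurable_pairWeight lam 0)]
  refine setLIntegral_congr_fun measurableSet_Ioi fun r (hr : 0 < r) => ?_
  have hsub : Set.Ioi r ∩ Set.Ioi 0 = Set.Ioi r := Set.inter_eq_left.2 (Set.Ioi_subset_Ioi hr.le)
  rw [← hsub, ← setLIntegral_indicator measurableSet_Ioi]
  refine setLIntegral_congr_fun measurableSet_Ioi fun s (hs : 0 < s) => ?_
  simp_rw [ofReal_mul_pairWeight_polarPoint lam hr hs, Set.indicator_apply, Set.mem_Ioi]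
  split_ifs <;> simp

/-! ### Change of radial variable and conclusion. -/

/-- The substitution `s = √(r² + u²)`. -/
theorem setLIntegral_Ioi_eq_sqrt {r : ℝ} (hr : 0 < r) (H : ℝ → ℝ≥0∞) :
    ∫⁻ s in Set.Ioi r, H s = ∫⁻ u in Set.Ioi (0 : ℝ),
      ENNReal.ofReal (u / Real.sqrt (r ^ 2 + u ^ 2)) * H (Real.sqrt (r ^ 2 + u ^ 2)) := by
  have himage : (fun u => Real.sqrt (r ^ 2 + u ^ 2)) '' Set.Ioi 0 = Set.Ioi r := by
    ext s
    constructor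
    · rintro ⟨u, hu : 0 < u, rfl⟩
      exact Real.lt_sqrt_of_sq_lt (by nlinarith)
    · intro (hs : r < s)
      refine ⟨Real.sqrt (s ^ 2 - r ^ 2), Real.sqrt_pos.2 (by nlinarith), ?_⟩
      dsimp only
      rw [Real.sq_sqrt (by nlinarith), add_sub_cancel, Real.sqrt_sq (by linarith)]
  rw [← himage, lintegral_image_eq_lintegral_abs_deriv_mul
    (f' := fun u => u / Real.sqrt (r ^ 2 + u ^ 2)) measurableSet_Ioi ?_ ?_]
  · refine setLIntegral_congr_fun measurableSet_Ioi fun u (hu : 0 < u) => ?_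
    rw [abs_of_nonneg (by positivity)]
  · intro u hu
    have h : HasDerivAt (fun u : ℝ => r ^ 2 + u ^ 2) (2 * u) u := by
      simpa using (hasDerivAt_pow 2 u).const_add (r ^ 2)
    have h' := h.sqrt (by positivity)
    rw [mul_div_mul_left _ _ (two_ne_zero)] at h'
    exact h'.hasDerivWithinAt
  · intro u (hu : 0 < u) v (hv : 0 < v) huv
    have := (Real.sqrt_inj (by positivity) (by positivity)).1 huv
    nlinarith

/-- The pair integral after the substitution `s ↦ √(r² + s²)`. -/
theorem lintegral_threeDisc_substitution (lam : ℝ) :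
    ∫⁻ r in Set.Ioi (0 : ℝ), ∫⁻ s in Set.Ioi r,
        ∫⁻ θ in Set.Ico (0 : ℝ) (2 * Real.pi), ∫⁻ φ in Set.Ico (0 : ℝ) (2 * Real.pi),
          ENNReal.ofReal
            (s * r * Real.exp (-lam * threeDiscArea r s θ φ - lam * Real.pi * r ^ 2)) =
      ∫⁻ s in Set.Ioi (0 : ℝ), ∫⁻ r in Set.Ioi (0 : ℝ),
        ∫⁻ θ in Set.Ico (0 : ℝ) (2 * Real.pi), ∫⁻ φ in Set.Ico (0 : ℝ) (2 * Real.pi),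
          ENNReal.ofReal (s * r * Real.exp
            (-lam * threeDiscArea r (Real.sqrt (r ^ 2 + s ^ 2)) θ φ - lam * Real.pi * r ^ 2)) := by
  have hG : Measurable fun q : ((ℝ × ℝ) × ℝ) × ℝ => ENNReal.ofReal
      (q.1.1.2 * q.1.1.1 * Real.exp (-lam * threeDiscArea q.1.1.1
        (Real.sqrt (q.1.1.1 ^ 2 + q.1.1.2 ^ 2)) q.1.2 q.2 - lam * Real.pi * q.1.1.1 ^ 2)) := by
    have h : Measurable fun q : ((ℝ × ℝ) × ℝ) × ℝ =>
        threeDiscArea q.1.1.1 (Real.sqrt (q.1.1.1 ^ 2 + q.1.1.2 ^ 2)) q.1.2 q.2 :=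
      measurable_threeDiscArea.comp (f := fun q : ((ℝ × ℝ) × ℝ) × ℝ =>
        (q.1.1.1, Real.sqrt (q.1.1.1 ^ 2 + q.1.1.2 ^ 2), q.1.2, q.2)) (by fun_prop)
    fun_prop
  -- The substitution depends on `r`, so `r` must be the outer variable.
  rw [← lintegral_lintegral_swap (f := fun r s =>
      ∫⁻ θ in Set.Ico (0 : ℝ) (2 * Real.pi), ∫⁻ φ in Set.Ico (0 : ℝ) (2 * Real.pi),
        ENNReal.ofReal (s * r * Real.exp
          (-lam * threeDiscArea r (Real.sqrt (r ^ 2 + s ^ 2)) θ φ - lam * Real.pi * r ^ 2)))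
    (Measurable.lintegral_prod_right (Measurable.lintegral_prod_right hG)).aemeasurable]
  refine setLIntegral_congr_fun measurableSet_Ioi fun r (hr : 0 < r) => ?_
  rw [setLIntegral_Ioi_eq_sqrt hr]
  refine setLIntegral_congr_fun measurableSet_Ioi fun u (hu : 0 < u) => ?_
  have hpos : 0 < Real.sqrt (r ^ 2 + u ^ 2) := Real.sqrt_pos.2 (by positivity)
  rw [← lintegral_const_mul' _ _ ENNReal.ofReal_ne_top]
  simp_rw [← lintegral_const_mul' _ _ ENNReal.ofReal_ne_top]
  congr with θ
  congr with φ
  -- The Jacobian `u / √(r² + u²)` cancels the old factor `s = √(r² + u²)`, leaving `u`.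
  rw [← ENNReal.ofReal_mul (by positivity)]
  congr 1
  field_simp

theorem proposition1 :
    ∃ F : ℝ × ℝ × ℝ × ℝ → ℝ≥0, Measurable F ∧
      (∀ r s θ φ : ℝ, 0 ≤ r → 0 ≤ s → θ ∈ Set.Ico 0 (2 * Real.pi) → φ ∈ Set.Ico 0 (2 * Real.pi) →
        (F (r, s, θ, φ) : ℝ) = threeDiscArea r (Real.sqrt (r ^ 2 + s ^ 2)) θ φ) ∧
      ∀ (lam : ℝ), 0 < lam →
      ∀ (Ω : Type*) [MeasurableSpace Ω] (P : Measure Ω) [IsProbabilityMeasure P]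
        (Φ : Ω → Set Plane), IsPoissonPointProcess P Φ lam →
        NullMeasurableSet (originInPairedCell Φ) P ∧
        P (originInPairedCell Φ) =
          ENNReal.ofReal (lam ^ 2) *
            ∫⁻ s in Set.Ioi (0 : ℝ), ∫⁻ r in Set.Ioi (0 : ℝ),
              ∫⁻ θ in Set.Ico (0 : ℝ) (2 * Real.pi), ∫⁻ φ in Set.Ico (0 : ℝ) (2 * Real.pi),
                ENNReal.ofReal
                  (s * r * Real.exp (-lam * F (r, s, θ, φ) - lam * Real.pi * r ^ 2)) ∧
        P (originInPairedCell Φ) =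
          ENNReal.ofReal (lam ^ 2) *
            ∫⁻ r in Set.Ioi (0 : ℝ), ∫⁻ s in Set.Ioi r,
              ∫⁻ θ in Set.Ico (0 : ℝ) (2 * Real.pi), ∫⁻ φ in Set.Ico (0 : ℝ) (2 * Real.pi),
                ENNReal.ofReal
                  (s * r * Real.exp (-lam * threeDiscArea r s θ φ - lam * Real.pi * r ^ 2)) := by
  have hcoe : ∀ r s θ φ : ℝ,
      ((threeDiscArea r s θ φ).toNNReal : ℝ) = threeDiscArea r s θ φ :=
    fun r s θ φ => Real.coe_toNNReal _ measureReal_nonneg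
  -- The truncation `toNNReal` is harmless, as an area is nonnegative.
  refine ⟨fun p => (threeDiscArea p.1 (Real.sqrt (p.1 ^ 2 + p.2.1 ^ 2)) p.2.2.1 p.2.2.2).toNNReal,
    ?_, fun r s θ φ _ _ _ _ => hcoe _ _ _ _, fun lam hlam Ω _ P _ Φ h => ?_⟩
  · exact (measurable_threeDiscArea.comp (f := fun q : ℝ × ℝ × ℝ × ℝ =>
      (q.1, Real.sqrt (q.1 ^ 2 + q.2.1 ^ 2), q.2.2.1, q.2.2.2)) (by fun_prop)).real_toNNReal
  · obtain ⟨hm, hP⟩ := h.originInPairedCell_spec hlam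
    rw [lintegral_pairWeight_polar, ← ENNReal.ofReal_pow hlam.le] at hP
    refine ⟨hm, ?_, hP⟩
    simp_rw [hcoe]
    rw [hP, lintegral_threeDisc_substitution]
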